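/- For a profinite group $\Pi$ let $\mu_\Pi$ be its Haar measure with $\mu_\Pi(\Pi)=1$, let $\mathrm{Fun}(\Pi)$ be the space of functions $\Pi\to\mathbb C$ that are bi-invariant under some open subgroup of $\Pi$, and define convolution on it by $(f_1*f_2)(\gamma)=\int_\Pi f_1(h)f_2(h^{-1}\gamma)\,d\mu_\Pi(h)$. Let $G$ be a profinite group, and suppose that there are an abelian profinite group $\mathfrak g$ (written additively) and a homeomorphism $\exp:\mathfrak g\to G$, $x\mapsto e^x$, with inverse $\log$, such that: (i) for each $g\in G$ the map $\operatorname{Ad} g:\mathfrak g\to\mathfrak g$, $x\mapsto\log(g\exp(x)g^{-1})$, is a group automorphism of $\mathfrak g$; (ii) the pullback map $\exp^*:f\mapsto f\circ\exp$ from the space $\mathrm{Fun}(G)^G$ of conjugation-invariant functions in $\mathrm{Fun}(G)$ to the space $\mathrm{Fun}(\mathfrak g)^G$ of $\operatorname{Ad}(G)$-invariant functions in $\mathrm{Fun}(\mathfrak g)$ commutes with convolution, that is, $\exp^*(f_1*f_2)=\exp^*(f_1)*\exp^*(f_2)$ for all $f_1,f_2\in\mathrm{Fun}(G)^G$. Let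 $\mathfrak g^*$ be the Pontryagin dual of $\mathfrak g$ (the group of continuous characters of $\mathfrak g$), on which $G$ acts by $(g\cdot f)(x)=f(\operatorname{Ad}(g^{-1})x)$, and let $\widehat G$ be the set of isomorphism classes of continuous irreducible complex representations of $G$ on Banach spaces (all of which are finite-dimensional). Then each $G$-orbit $\Omega\subset\mathfrak g^*$ is finite, and there is a bijection between the set $\mathfrak g^*/G$ of orbits and $\widehat G$ such that the character $\chi$ of the irreducible representation corresponding to an orbit $\Omega$ is given by $$\chi(e^x)=|\Omega|^{-1/2}\sum_{f\in\Omega}f(x)\qquad(x\in\mathfrak g).$$ -/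

import Mathlib

universe u v w

open MeasureTheory TopologicalSpace

noncomputable section

namespace OrbitMethod

/-- Convolution of complex functions on a compact group with respect to the Haar measure of
total mass one. -/
def conv {G : Type*} [Group G] [TopologicalSpace G] [IsTopologicalGroup G] [CompactSpace G]
    [MeasurableSpace G] [BorelSpace G] (f₁ f₂ : G → ℂ) (γ : G) : ℂ :=
  ∫ h, f₁ h * f₂ (h⁻¹ * γ) ∂(Measure.haarMeasure (⊤ : PositiveCompacts G))

/-- Convolution of complex functions on an additively written compact group with respect to the
Haar measure of total mass one. -/
def addConv {A : Type*} [AddGroup A] [TopologicalSpace A] [IsTopologicalAddGroup A]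
    [CompactSpace A] [MeasurableSpace A] [BorelSpace A] (f₁ f₂ : A → ℂ) (x : A) : ℂ :=
  ∫ y, f₁ y * f₂ (-y + x) ∂(Measure.addHaarMeasure (⊤ : PositiveCompacts A))

/-- `Fun(G)`: the complex functions on `G` that are bi-invariant under some open subgroup. -/
def Fun (G : Type*) [Group G] [TopologicalSpace G] : Set (G → ℂ) :=
  {f | ∃ U : OpenSubgroup G, ∀ u ∈ U, ∀ g, f (u * g) = f g ∧ f (g * u) = f g}

/-- `Fun(G)^G`: the elements of `Fun(G)` that are invariant under conjugation. -/
def ClassFun (G : Type*) [Group G] [TopologicalSpace G] : Set (G → ℂ) :=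
  {f | f ∈ Fun G ∧ ∀ g h, f (g * h * g⁻¹) = f h}

section Adjoint

variable {G A : Type*} [Group G] [TopologicalSpace G] [AddCommGroup A] [TopologicalSpace A]

/-- `Ad g : x ↦ log (g exp(x) g⁻¹)`. -/
def Ad (e : A ≃ₜ G) (g : G) (x : A) : A := e.symm (g * e x * g⁻¹)

/-- The Pontryagin dual of an additively written topological abelian group. -/
abbrev Dual (A : Type*) [AddCommGroup A] [TopologicalSpace A] : Type _ :=
  PontryaginDual (Multiplicative A)

/-- The complex value `f(x)` of a continuous character `f` at `x`. -/
def Dual.eval (f : Dual A) (x : A) : ℂ := ((f (Multiplicative.ofAdd x) : Circle) : ℂ)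

/-- The `G`-orbit of `f` in the dual: all the characters of the form `g • f = f ∘ Ad g⁻¹`. -/
def coadjointOrbit (e : A ≃ₜ G) (f : Dual A) : Set (Dual A) :=
  {f' | ∃ g : G, ∀ x : A, f'.eval x = f.eval (Ad e g⁻¹ x)}

/-- The set of `G`-orbits in the dual. -/
def coadjointOrbits (e : A ≃ₜ G) : Set (Set (Dual A)) := Set.range (coadjointOrbit e)

end Adjoint

/-- A continuous (topologically) irreducible representation of `G` on a complex Banach space.
No finite-dimensionality and no unitarity is imposed. -/
structure Irrep (G : Type u) [Group G] [TopologicalSpace G] where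
  /-- The underlying space. -/
  V : Type w
  [normed : NormedAddCommGroup V]
  [space : NormedSpace ℂ V]
  [complete : CompleteSpace V]
  /-- The action. -/
  ρ : ContRepresentation ℂ G V
  continuous_action : Continuous fun p : G × V => ρ p.1 p.2
  nontrivial : Nontrivial V
  irreducible : ∀ W : Submodule ℂ V, IsClosed (W : Set V) → (∀ g, ∀ w ∈ W, ρ g w ∈ W) →
    W = ⊥ ∨ W = ⊤

attribute [instance] Irrep.normed Irrep.space Irrep.complete

/-- Isomorphism of representations: an equivariant linear homeomorphism. -/
instance Irrep.setoid (G : Type u) [Group G] [TopologicalSpace G] : Setoid (Irrep.{u, w} G) where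
  r π σ := Nonempty (π.ρ.Equiv σ.ρ)
  iseqv :=
    { refl := fun π => ⟨ContRepresentation.Equiv.refl π.ρ⟩
      symm := fun ⟨φ⟩ => ⟨φ.symm⟩
      trans := fun ⟨φ⟩ ⟨ψ⟩ => ⟨φ.trans ψ⟩ }

/-- `Ĝ`: the isomorphism classes of continuous complex irreducible representations of `G`. -/
def IrrepClass (G : Type u) [Group G] [TopologicalSpace G] : Type _ :=
  Quotient (Irrep.setoid.{u, w} G)

/-- The class in `Ĝ` of an irreducible representation. -/
def Irrep.toClass {G : Type u} [Group G] [TopologicalSpace G] (π : Irrep.{u, w} G) :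
    IrrepClass.{u, w} G :=
  Quotient.mk (Irrep.setoid G) π

/-- The character `g ↦ tr π(g)`; meaningful when the space of `π` is finite-dimensional. -/
def Irrep.character {G : Type u} [Group G] [TopologicalSpace G] (π : Irrep.{u, w} G) (g : G) : ℂ :=
  LinearMap.trace ℂ π.V (π.ρ g : π.V →ₗ[ℂ] π.V)

end OrbitMethod

end

namespace Representation

section Irreducible

variable {k H V : Type*} [Field k] [Monoid H] [AddCommGroup V] [Module k V]

theorem isIrreducible_of_forall [Nontrivial V] (ρ : Representation k H V)
    (h : ∀ W : Submodule k V, (∀ g, ∀ w ∈ W, ρ g w ∈ W) → W = ⊥ ∨ W = ⊤) : ρ.IsIrreducible where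
  exists_pair_ne := by
    obtain ⟨v, hv⟩ := exists_ne (0 : V)
    refine ⟨⊥, ⊤, fun hbt => hv ?_⟩
    have : v ∈ (⊤ : Subrepresentation ρ) := Submodule.mem_top
    rw [← hbt] at this
    exact (Submodule.mem_bot k).1 this
  eq_bot_or_eq_top W := by
    rcases h W.toSubmodule (fun g w hw => W.apply_mem_toSubmodule g hw) with h | h
    · exact Or.inl (Subrepresentation.toSubmodule_injective h)
    · exact Or.inr (Subrepresentation.toSubmodule_injective h)

theorem IsIrreducible.submodule_eq_bot_or_eq_top {ρ : Representation k H V} (hρ : ρ.IsIrreducible)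
    (W : Submodule k V) (hW : ∀ g, ∀ w ∈ W, ρ g w ∈ W) : W = ⊥ ∨ W = ⊤ := by
  rcases hρ.eq_bot_or_eq_top ⟨W, fun g w hw => hW g w hw⟩ with h | h
  · exact Or.inl (congrArg Subrepresentation.toSubmodule h)
  · exact Or.inr (congrArg Subrepresentation.toSubmodule h)

theorem IsIrreducible.nontrivial {ρ : Representation k H V} (hρ : ρ.IsIrreducible) :
    Nontrivial V := by
  by_contra hV
  rw [not_nontrivial_iff_subsingleton] at hV
  obtain ⟨X, Y, hXY⟩ := hρ.exists_pair_ne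
  exact hXY (Subrepresentation.toSubmodule_injective (Subsingleton.elim _ _))

/-- Schur's lemma. -/
theorem IsIrreducible.exists_eq_smul [IsAlgClosed k] [FiniteDimensional k V]
    {ρ : Representation k H V} (hρ : ρ.IsIrreducible) (T : V →ₗ[k] V)
    (hT : ∀ g, T ∘ₗ ρ g = ρ g ∘ₗ T) : ∃ c : k, T = c • LinearMap.id := by
  obtain ⟨c, hc⟩ :=
    (IsIrreducible.algebraMap_intertwiningMap_bijective_of_isAlgClosed (ρ := ρ)).2 ⟨T, hT⟩
  refine ⟨c, ?_⟩
  ext v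
  have := congrArg (fun f : IntertwiningMap ρ ρ => f v) hc
  exact this.symm

end Irreducible

section FiniteGroup

variable {H V : Type*} [Group H] [Fintype H] [AddCommGroup V] [Module ℂ V]
  [FiniteDimensional ℂ V]

/-- Convolution with a class function multiplies an irreducible character by a scalar. -/
theorem IsIrreducible.exists_sum_mul_character_eq {ρ : Representation ℂ H V}
    (hρ : ρ.IsIrreducible) (f : H → ℂ) (hf : ∀ g h, f (g * h * g⁻¹) = f h) :
    ∃ c : ℂ, (∑ h, f h • ρ h⁻¹ = c • LinearMap.id) ∧
      ∀ x, ∑ h, f h * ρ.character (h⁻¹ * x) = c * ρ.character x := by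
  obtain ⟨c, hc⟩ := hρ.exists_eq_smul (∑ h, f h • ρ h⁻¹) (by
    intro g
    rw [← Module.End.mul_eq_comp, ← Module.End.mul_eq_comp, Finset.sum_mul, Finset.mul_sum]
    refine Fintype.sum_equiv (MulAut.conj g⁻¹).toEquiv _ _ fun h => ?_
    rw [smul_mul_assoc, mul_smul_comm]
    have h1 : f ((MulAut.conj g⁻¹).toEquiv h) = f h := hf g⁻¹ h
    have h2 : g * ((MulAut.conj g⁻¹).toEquiv h)⁻¹ = h⁻¹ * g := by
      simp [mul_assoc]
    rw [h1, ← map_mul, ← map_mul, h2])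
  refine ⟨c, hc, fun x => ?_⟩
  have := congrArg (fun T => LinearMap.trace ℂ V (T * ρ x)) hc
  simp only [Finset.sum_mul, map_sum, smul_mul_assoc, ← map_mul, map_smul, smul_eq_mul] at this
  rw [character]
  simp only [character, this]
  rfl

theorem IsIrreducible.sum_character_mul_character_inv {ρ : Representation ℂ H V}
    (hρ : ρ.IsIrreducible) :
    (Nat.card H : ℂ)⁻¹ * ∑ h, ρ.character h * ρ.character h⁻¹ = 1 := by
  classical
  have : Invertible (Nat.card H : ℂ) := invertibleOfNonzero (by simp)
  rw [char_orthonormal, if_pos ⟨Equiv.refl ρ⟩]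

/-- Irreducible representations with the same character are isomorphic. -/
theorem IsIrreducible.nonempty_equiv_of_character_eq {W : Type*} [AddCommGroup W] [Module ℂ W]
    [FiniteDimensional ℂ W] {ρ : Representation ℂ H V} {σ : Representation ℂ H W}
    (hρ : ρ.IsIrreducible) (hσ : σ.IsIrreducible) (h : ρ.character = σ.character) :
    Nonempty (ρ.Equiv σ) := by
  classical
  have : Invertible (Nat.card H : ℂ) := invertibleOfNonzero (by simp)
  by_contra hne
  have h1 := char_orthonormal σ ρ
  rw [if_neg hne, h, hσ.sum_character_mul_character_inv] at h1
  exact one_ne_zero h1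

/-- An irreducible character is idempotent under convolution, up to its degree. -/
theorem IsIrreducible.sum_character_mul_character {ρ : Representation ℂ H V}
    (hρ : ρ.IsIrreducible) (x : H) :
    (Nat.card H : ℂ)⁻¹ * ∑ h, ρ.character h * ρ.character (h⁻¹ * x) =
      (Module.finrank ℂ V : ℂ)⁻¹ * ρ.character x := by
  obtain ⟨c, -, hc⟩ := hρ.exists_sum_mul_character_eq ρ.character fun g h => ρ.char_conj h g
  have h1 := hρ.sum_character_mul_character_inv
  have h2 := hc 1
  simp only [mul_one, char_one] at h2
  have := hρ.nontrivial
  have hd : (Module.finrank ℂ V : ℂ) ≠ 0 := by exact_mod_cast Module.finrank_pos.ne'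
  rw [h2] at h1
  rw [hc, ← mul_assoc, eq_inv_of_mul_eq_one_left (a := _ * c) (by rw [mul_assoc]; exact h1)]

/-- A central element acts by a root of unity. -/
theorem IsIrreducible.exists_pow_card_eq_one {ρ : Representation ℂ H V}
    (hρ : ρ.IsIrreducible) (z : H) (hz : ∀ g, g * z = z * g) :
    ∃ c : ℂ, c ^ Nat.card H = 1 ∧ ρ.character z = c * Module.finrank ℂ V := by
  obtain ⟨c, hc⟩ := hρ.exists_eq_smul (ρ z) (fun g => by
    rw [← Module.End.mul_eq_comp, ← Module.End.mul_eq_comp, ← map_mul, ← map_mul, hz])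
  have := hρ.nontrivial
  refine ⟨c, ?_, by simp [character, hc]⟩
  have h1 : ρ z ^ Nat.card H = 1 := by rw [← map_pow, pow_card_eq_one', map_one]
  rw [hc, ← Module.End.one_eq_id, smul_pow, one_pow] at h1
  obtain ⟨v, hv⟩ := exists_ne (0 : V)
  have h2 := congrArg (fun T : Module.End ℂ V => T v) h1
  simp only [LinearMap.smul_apply, Module.End.one_apply] at h2
  exact smul_left_injective ℂ hv (by simpa using h2)

open scoped MonoidAlgebra in
/-- A nonzero class function acts nontrivially in some irreducible representation. -/
theorem exists_isIrreducible_sum_ne_zero {H : Type u} [Group H] [Fintype H] (f : H → ℂ)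
    (hf : f ≠ 0) :
    ∃ (V : Type u) (_ : AddCommGroup V) (_ : Module ℂ V) (_ : FiniteDimensional ℂ V)
      (ρ : Representation ℂ H V), ρ.IsIrreducible ∧ ∑ h, f h • ρ h⁻¹ ≠ 0 := by
  classical
  let a : ℂ[H] := ∑ h, MonoidAlgebra.single h⁻¹ (f h)
  have ha : a ≠ 0 := by
    intro h0
    apply hf
    funext h
    have := congrArg (fun x : ℂ[H] => x.coeff h⁻¹) h0
    simpa [a, MonoidAlgebra.coeff_sum, Finsupp.single_apply] using this
  have : NeZero (Nat.card H : ℂ) := ⟨by simp⟩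
  have hI : ∃ I : Submodule ℂ[H] ℂ[H], IsSimpleModule ℂ[H] I ∧ ∃ x ∈ I, a * x ≠ 0 := by
    by_contra! hcon
    apply ha
    have h1 : (1 : ℂ[H]) ∈ sSup {m : Submodule ℂ[H] ℂ[H] | IsSimpleModule ℂ[H] m} := by
      rw [IsSemisimpleModule.sSup_simples_eq_top]; trivial
    have h2 : a * 1 = 0 := by
      rw [sSup_eq_iSup'] at h1
      refine Submodule.iSup_induction (motive := fun x => a * x = 0) _ h1 ?_ (mul_zero a) ?_
      · exact fun I x hx => hcon I.1 I.2 x hx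
      · intro x y hx hy
        rw [mul_add, hx, hy, add_zero]
    rwa [mul_one] at h2
  obtain ⟨I, hI, x, hx, hax⟩ := hI
  have hfin : FiniteDimensional ℂ ℂ[H] := inferInstance
  have hfin : FiniteDimensional ℂ I :=
    FiniteDimensional.of_injective (I.subtype.restrictScalars ℂ) Subtype.val_injective
  have := IsSimpleModule.nontrivial ℂ[H] I
  have hact (h : H) (y : I) : ofModule' (k := ℂ) (G := H) I h y =
      MonoidAlgebra.single h (1 : ℂ) • y := rfl
  refine ⟨I, inferInstance, inferInstance, hfin, ofModule' I, isIrreducible_of_forall _ ?_,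
    fun h0 => hax ?_⟩
  · intro W hW
    have hsmul (b : ℂ[H]) (y : I) (hy : y ∈ W) : b • y ∈ W := by
      induction b using MonoidAlgebra.induction_on with
      | of h => exact hW h y hy
      | add b c hb hc => rw [add_smul]; exact W.add_mem hb hc
      | smul r b hb => rw [smul_assoc]; exact W.smul_mem r hb
    let W' : Submodule ℂ[H] I :=
      { carrier := W
        add_mem' := W.add_mem
        zero_mem' := W.zero_mem
        smul_mem' := fun b y hy => hsmul b y hy }
    rcases IsSimpleOrder.eq_bot_or_eq_top W' with h | h
    · exact Or.inl (SetLike.coe_injective (congrArg (fun Z : Submodule ℂ[H] I => (Z : Set I)) h))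
    · exact Or.inr (SetLike.coe_injective (congrArg (fun Z : Submodule ℂ[H] I => (Z : Set I)) h))
  · have h1 := congrArg (fun T : I →ₗ[ℂ] I => (T ⟨x, hx⟩ : ℂ[H])) h0
    simp only [LinearMap.sum_apply, LinearMap.smul_apply, hact] at h1
    simpa [a, Finset.sum_mul, ← smul_mul_assoc] using h1

end FiniteGroup

end Representation

namespace OrbitMethod

section Haar

@[to_additive isLocallyConstant_of_forall_add_mem]
theorem isLocallyConstant_of_forall_mem {G : Type*} [Group G]
    [TopologicalSpace G] [IsTopologicalGroup G] {X : Type*} {f : G → X} (N : Subgroup G)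
    (hN : IsOpen (N : Set G)) (hf : ∀ g, ∀ n ∈ N, f (g * n) = f g) : IsLocallyConstant f := by
  rw [IsLocallyConstant.iff_eventually_eq]
  intro g
  have : ∀ᶠ h in nhds g, g⁻¹ * h ∈ N :=
    (continuous_const.mul continuous_id).continuousAt.preimage_mem_nhds
      (hN.mem_nhds (by simp [N.one_mem]))
  filter_upwards [this] with h hh
  rw [← hf g _ hh, mul_inv_cancel_left]

variable {G : Type*} [Group G] [TopologicalSpace G] [IsTopologicalGroup G] [CompactSpace G]

@[to_additive exists_add_openNormal_of_isLocallyConstant]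
theorem exists_openNormal_of_isLocallyConstant [TotallyDisconnectedSpace G] {X : Type*}
    {f : G → X} (hf : IsLocallyConstant f) :
    ∃ N : Subgroup G, N.Normal ∧ IsOpen (N : Set G) ∧ ∀ g, ∀ n ∈ N, f (g * n) = f g := by
  have h1 : ∀ᶠ n in nhds (1 : G), ∀ g ∈ (Set.univ : Set G), f (g * n) = f g := by
    refine isCompact_univ.eventually_forall_of_forall_eventually fun g _ => ?_
    have h2 : IsOpen {p : G × G | f (p.2 * p.1) = f p.2} := by
      have h3 : IsLocallyConstant fun p : G × G => (f (p.2 * p.1), f p.2) :=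
        (hf.comp_continuous (continuous_snd.mul continuous_fst)).prodMk
          (hf.comp_continuous continuous_snd)
      exact h3 {q | q.1 = q.2}
    exact h2.mem_nhds (by simp)
  obtain ⟨U, hU, hUo, h1U⟩ := eventually_nhds_iff.1 h1
  obtain ⟨N, hN⟩ := ProfiniteGrp.exist_openNormalSubgroup_sub_open_nhds_of_one hUo h1U
  exact ⟨N.toSubgroup, N.isNormal', N.isOpen', fun g n hn => hU n (hN hn) g trivial⟩

variable [MeasurableSpace G] [BorelSpace G]

@[to_additive]
instance isProbabilityMeasure_haarMeasure_top :
    IsProbabilityMeasure (Measure.haarMeasure (⊤ : PositiveCompacts G)) :=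
  ⟨by simpa using Measure.haarMeasure_self (K₀ := (⊤ : PositiveCompacts G))⟩

@[to_additive]
theorem integrable_haarMeasure_top {E : Type*} [NormedAddCommGroup E] {f : G → E}
    (hf : Continuous f) : Integrable f (Measure.haarMeasure (⊤ : PositiveCompacts G)) :=
  hf.integrable_of_hasCompactSupport (HasCompactSupport.of_compactSpace f)

/-- The Haar integral of a function that factors through a finite quotient is the average over
the quotient. -/
@[to_additive integral_comp_add_quotientMk]
theorem integral_comp_quotientMk (N : Subgroup G) (hN : IsOpen (N : Set G)) [Fintype (G ⧸ N)]
    (φ : G ⧸ N → ℂ) :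
    ∫ g, φ (QuotientGroup.mk g) ∂(Measure.haarMeasure (⊤ : PositiveCompacts G)) =
      (Nat.card (G ⧸ N) : ℂ)⁻¹ * ∑ c, φ c := by
  classical
  set μ := Measure.haarMeasure (⊤ : PositiveCompacts G)
  have hdis : DiscreteTopology (G ⧸ N) := QuotientGroup.discreteTopology hN
  have hopen (c : G ⧸ N) : IsOpen ((QuotientGroup.mk : G → G ⧸ N) ⁻¹' {c}) :=
    (isOpen_discrete {c}).preimage QuotientGroup.continuous_mk
  have hμ (c : G ⧸ N) : μ.real ((QuotientGroup.mk : G → G ⧸ N) ⁻¹' {c}) = μ.real (N : Set G) := by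
    obtain ⟨g, rfl⟩ := QuotientGroup.mk_surjective c
    have : (QuotientGroup.mk : G → G ⧸ N) ⁻¹' {QuotientGroup.mk g} =
        (fun h => g⁻¹ * h) ⁻¹' (N : Set G) := by
      ext h
      simp only [Set.mem_preimage, Set.mem_singleton_iff, SetLike.mem_coe]
      rw [eq_comm, QuotientGroup.eq]
    rw [this, measureReal_def, measure_preimage_mul, measureReal_def]
  have key (ψ : G ⧸ N → ℂ) : ∫ g, ψ (QuotientGroup.mk g) ∂μ = μ.real (N : Set G) * ∑ c, ψ c := by
    have h1 (g : G) : ψ (QuotientGroup.mk g) =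
        ∑ c, ((QuotientGroup.mk : G → G ⧸ N) ⁻¹' {c}).indicator (fun _ => ψ c) g := by
      rw [Finset.sum_eq_single (QuotientGroup.mk g : G ⧸ N)]
      · simp
      · intro c _ hc
        simp [Set.indicator, Ne.symm hc]
      · simp
    simp_rw [h1]
    rw [integral_finsetSum, Finset.mul_sum]
    · refine Finset.sum_congr rfl fun c _ => ?_
      rw [integral_indicator_const _ (hopen c).measurableSet, hμ, Complex.real_smul]
    · exact fun c _ => (integrable_const _).indicator (hopen c).measurableSet
  have h2 := key fun _ => 1
  simp only [integral_const, probReal_univ, one_smul, Finset.sum_const, Finset.card_univ,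
    nsmul_eq_mul, mul_one] at h2
  rw [key, Nat.card_eq_fintype_card, eq_inv_of_mul_eq_one_left h2.symm]

end Haar

section Fun

variable {G : Type*} [Group G] [TopologicalSpace G] [IsTopologicalGroup G] [CompactSpace G]

theorem isLocallyConstant_of_mem_Fun {G : Type*} [Group G] [TopologicalSpace G]
    [IsTopologicalGroup G] {f : G → ℂ} (hf : f ∈ Fun G) : IsLocallyConstant f := by
  obtain ⟨U, hU⟩ := hf
  exact isLocallyConstant_of_forall_mem U.toSubgroup U.isOpen' fun g n hn => (hU n hn g).2

theorem mem_Fun_of_openNormal {G : Type*} [Group G] [TopologicalSpace G] {f : G → ℂ}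
    (N : Subgroup G) (hN : N.Normal)
    (hNo : IsOpen (N : Set G)) (hf : ∀ g, ∀ n ∈ N, f (g * n) = f g) : f ∈ Fun G := by
  refine ⟨⟨N, hNo⟩, fun n hn g => ⟨?_, hf g n hn⟩⟩
  rw [← hf g (g⁻¹ * n * g) (hN.conj_mem' n hn g)]
  congr 1
  group

theorem mem_Fun_of_isLocallyConstant [TotallyDisconnectedSpace G] {f : G → ℂ}
    (hf : IsLocallyConstant f) : f ∈ Fun G := by
  obtain ⟨N, hN, hNo, h⟩ := exists_openNormal_of_isLocallyConstant hf
  exact mem_Fun_of_openNormal N hN hNo h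

variable [MeasurableSpace G] [BorelSpace G]

/-- Convolution of functions on a finite quotient. -/
theorem conv_comp_quotientMk (N : Subgroup G) [N.Normal] (hN : IsOpen (N : Set G))
    [Fintype (G ⧸ N)] (φ ψ : G ⧸ N → ℂ) (γ : G) :
    conv (fun g : G => φ (g : G ⧸ N)) (fun g : G => ψ (g : G ⧸ N)) γ =
      (Nat.card (G ⧸ N) : ℂ)⁻¹ * ∑ c, φ c * ψ (c⁻¹ * (γ : G ⧸ N)) :=
  integral_comp_quotientMk N hN fun c => φ c * ψ (c⁻¹ * (γ : G ⧸ N))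

end Fun

section Irrep

variable {G : Type u} [Group G] [TopologicalSpace G]

attribute [instance] Irrep.nontrivial

theorem Irrep.continuous_orbitMap (π : Irrep.{u, w} G) (v : π.V) : Continuous fun g => π.ρ g v :=
  π.continuous_action.comp (continuous_id.prodMk continuous_const)

theorem Irrep.map_mul_apply (π : Irrep.{u, w} G) (g h : G) (v : π.V) :
    π.ρ (g * h) v = π.ρ g (π.ρ h v) := by
  rw [map_mul]; rfl

theorem Irrep.map_one_apply (π : Irrep.{u, w} G) (v : π.V) : π.ρ 1 v = v := by
  rw [map_one]; rfl

variable [IsTopologicalGroup G] [CompactSpace G]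

/-- Averaging over a small open subgroup produces a nonzero invariant vector. -/
theorem Irrep.exists_invariant_ne_zero [TotallyDisconnectedSpace G] [MeasurableSpace G]
    [BorelSpace G] (π : Irrep.{u, w} G) :
    ∃ N : Subgroup G, N.Normal ∧ IsOpen (N : Set G) ∧
      ∃ w : π.V, w ≠ 0 ∧ ∀ n ∈ N, π.ρ n w = w := by
  obtain ⟨v, hv⟩ := exists_ne (0 : π.V)
  have hU : IsOpen {g : G | ‖π.ρ g v - v‖ < ‖v‖ / 2} :=
    isOpen_lt ((π.continuous_orbitMap v).sub continuous_const).norm continuous_const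
  obtain ⟨N, hN⟩ := ProfiniteGrp.exist_openNormalSubgroup_sub_open_nhds_of_one hU
    (by simpa [π.map_one_apply] using hv)
  refine ⟨N.toSubgroup, N.isNormal', N.isOpen', ?_⟩
  set μ := Measure.haarMeasure (⊤ : PositiveCompacts G)
  have hNm : MeasurableSet (N : Set G) := N.isOpen'.measurableSet
  have hNpos : 0 < μ.real (N : Set G) := by
    rw [measureReal_def]
    exact ENNReal.toReal_pos (N.isOpen'.measure_pos μ ⟨1, N.one_mem'⟩).ne' (measure_ne_top _ _)
  have hint : Integrable (fun g => π.ρ g v) μ :=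
    integrable_haarMeasure_top (π.continuous_orbitMap v)
  refine ⟨∫ g in (N : Set G), π.ρ g v ∂μ, fun h0 => ?_, fun n hn => ?_⟩
  · have h1 : ∫ g in (N : Set G), (π.ρ g v - v) ∂μ = -(μ.real (N : Set G) • v) := by
      rw [integral_sub hint.integrableOn (integrable_const _).integrableOn, h0, zero_sub,
        setIntegral_const]
    have h2 : ‖∫ g in (N : Set G), (π.ρ g v - v) ∂μ‖ ≤ ‖v‖ / 2 * μ.real (N : Set G) :=
      norm_setIntegral_le_of_norm_le_const (measure_lt_top _ _) fun g hg => (hN hg).le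
    rw [h1, norm_neg, norm_smul, Real.norm_of_nonneg hNpos.le] at h2
    have := norm_pos_iff.2 hv
    nlinarith
  · rw [← ContinuousLinearMap.integral_comp_comm _ hint.integrableOn,
      ← integral_indicator hNm, ← integral_indicator hNm,
      ← integral_mul_left_eq_self (fun g => (N : Set G).indicator (fun g => π.ρ g v) g) n]
    congr 1
    funext g
    by_cases hg : g ∈ N.toSubgroup
    · have hng : n * g ∈ (N : Set G) := N.toSubgroup.mul_mem hn hg
      have hg' : g ∈ (N : Set G) := hg
      rw [Set.indicator_of_mem hng, Set.indicator_of_mem hg', π.map_mul_apply]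
    · have hng : n * g ∉ (N : Set G) := fun h => hg ((N.toSubgroup.mul_mem_cancel_left hn).1 h)
      have hg' : g ∉ (N : Set G) := hg
      rw [Set.indicator_of_notMem hng, Set.indicator_of_notMem hg']

/-- An irreducible Banach representation of a profinite group is trivial on an open normal
subgroup. -/
theorem Irrep.exists_openNormal_trivial [TotallyDisconnectedSpace G] [MeasurableSpace G]
    [BorelSpace G] (π : Irrep.{u, w} G) :
    ∃ N : Subgroup G, N.Normal ∧ IsOpen (N : Set G) ∧ ∀ n ∈ N, π.ρ n = 1 := by
  obtain ⟨N, hN, hNo, w, hw, hinv⟩ := π.exists_invariant_ne_zero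
  refine ⟨N, hN, hNo, ?_⟩
  let W : Submodule ℂ π.V :=
    { carrier := {v | ∀ n ∈ N, π.ρ n v = v}
      add_mem' := fun ha hb n hn => by rw [map_add, ha n hn, hb n hn]
      zero_mem' := fun n _ => map_zero _
      smul_mem' := fun c v hv n hn => by rw [map_smul, hv n hn] }
  have hWc : IsClosed (W : Set π.V) := by
    have : (W : Set π.V) = ⋂ n ∈ N, {v | π.ρ n v = v} := by
      ext v; simp [W]
    rw [this]
    exact isClosed_biInter fun n _ => isClosed_eq (π.ρ n).continuous continuous_id
  rcases π.irreducible W hWc (fun g v hv n hn => by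
    rw [← π.map_mul_apply, show n * g = g * (g⁻¹ * n * g) by group, π.map_mul_apply,
      hv _ (hN.conj_mem' n hn g)]) with h | h
  · exact absurd ((Submodule.mem_bot ℂ).1 (h ▸ (show w ∈ W from hinv))) hw
  · intro n hn
    ext v
    have hv : v ∈ W := h ▸ Submodule.mem_top
    exact hv n hn

/-- The representation of a quotient through which an irreducible representation factors. -/
def Irrep.quotientRep (π : Irrep.{u, w} G) (N : Subgroup G) [N.Normal]
    (hN : ∀ n ∈ N, π.ρ n = 1) : Representation ℂ (G ⧸ N) π.V :=
  QuotientGroup.lift N π.ρ.toRepresentation fun n hn => by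
    ext v
    exact congrArg (fun T : π.V →L[ℂ] π.V => T v) (hN n hn)

omit [IsTopologicalGroup G] [CompactSpace G] in
theorem Irrep.character_quotientRep (π : Irrep.{u, w} G) (N : Subgroup G) [N.Normal]
    (hN : ∀ n ∈ N, π.ρ n = 1) (g : G) :
    (π.quotientRep N hN).character (g : G ⧸ N) = π.character g := rfl

theorem Irrep.finiteDimensional_of_trivial (π : Irrep.{u, w} G) (N : Subgroup G) [N.Normal]
    (hNo : IsOpen (N : Set G)) (hN : ∀ n ∈ N, π.ρ n = 1) : FiniteDimensional ℂ π.V := by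
  have hfin : Finite (G ⧸ N) := N.quotient_finite_of_isOpen hNo
  obtain ⟨v, hv⟩ := exists_ne (0 : π.V)
  let S : Set π.V := Set.range fun c : G ⧸ N => π.quotientRep N hN c v
  have hS : FiniteDimensional ℂ (Submodule.span ℂ S) :=
    FiniteDimensional.span_of_finite ℂ (Set.finite_range _)
  have hvS : v ∈ Submodule.span ℂ S := Submodule.subset_span ⟨1, by simp⟩
  rcases π.irreducible (Submodule.span ℂ S) (Submodule.closed_of_finiteDimensional _)
    (fun g w hw => by
      induction hw using Submodule.span_induction with
      | mem x hx =>
        obtain ⟨c, rfl⟩ := hx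
        refine Submodule.subset_span ⟨(g : G ⧸ N) * c, ?_⟩
        simp only [map_mul]
        rfl
      | zero => rw [map_zero]; exact Submodule.zero_mem _
      | add x y _ _ hx hy => rw [map_add]; exact Submodule.add_mem _ hx hy
      | smul c x _ hx => rw [map_smul]; exact Submodule.smul_mem _ c hx) with h | h
  · rw [h, Submodule.mem_bot] at hvS
    exact absurd hvS hv
  · rw [h] at hS
    exact LinearEquiv.finiteDimensional (Submodule.topEquiv (R := ℂ) (M := π.V))

theorem Irrep.isIrreducible_quotientRep (π : Irrep.{u, w} G) (N : Subgroup G) [N.Normal]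
    (hNo : IsOpen (N : Set G)) (hN : ∀ n ∈ N, π.ρ n = 1) :
    (π.quotientRep N hN).IsIrreducible := by
  have := π.finiteDimensional_of_trivial N hNo hN
  exact Representation.isIrreducible_of_forall _ fun W hW =>
    π.irreducible W (Submodule.closed_of_finiteDimensional _) fun g w hw => hW g w hw

theorem Irrep.finiteDimensional [TotallyDisconnectedSpace G] [MeasurableSpace G]
    [BorelSpace G] (π : Irrep.{u, w} G) : FiniteDimensional ℂ π.V := by
  obtain ⟨N, hN, hNo, h⟩ := π.exists_openNormal_trivial
  exact π.finiteDimensional_of_trivial N hNo h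

omit [CompactSpace G] in
/-- Every irreducible representation of a finite quotient comes from an irreducible representation
of the group, in any universe. -/
theorem exists_irrep_of_quotient (N : Subgroup G) [N.Normal] (hNo : IsOpen (N : Set G))
    {V : Type v} [AddCommGroup V] [Module ℂ V] [FiniteDimensional ℂ V]
    (ρ : Representation ℂ (G ⧸ N) V) (hρ : ρ.IsIrreducible) :
    ∃ π : Irrep.{u, w} G, ∀ g, π.character g = ρ.character (g : G ⧸ N) := by
  have := hρ.nontrivial
  let L : V ≃ₗ[ℂ] (ULift.{w} (Fin (Module.finrank ℂ V)) → ℂ) :=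
    (Module.finBasis ℂ V).equivFun.trans (LinearEquiv.funCongrLeft ℂ ℂ Equiv.ulift)
  let T : G →* (ULift.{w} (Fin (Module.finrank ℂ V)) → ℂ) →L[ℂ]
      (ULift.{w} (Fin (Module.finrank ℂ V)) → ℂ) :=
    { toFun := fun g => LinearMap.toContinuousLinearMap (L.conj (ρ (g : G ⧸ N)))
      map_one' := by
        ext1 x
        simp [LinearEquiv.conj_apply]
      map_mul' := fun g h => by
        ext1 x
        simp [LinearEquiv.conj_apply] }
  have hT (g : G) (x) : T g x = L (ρ (g : G ⧸ N) (L.symm x)) := rfl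
  have hdis : DiscreteTopology (G ⧸ N) := QuotientGroup.discreteTopology hNo
  refine ⟨{ V := ULift.{w} (Fin (Module.finrank ℂ V)) → ℂ
            ρ := ⟨T⟩
            continuous_action := ?_
            nontrivial := L.symm.toEquiv.nontrivial
            irreducible := ?_ }, fun g => ?_⟩
  · have h1 : Continuous fun p : (G ⧸ N) × (ULift.{w} (Fin (Module.finrank ℂ V)) → ℂ) =>
        L (ρ p.1 (L.symm p.2)) :=
      continuous_prod_of_discrete_left.2 fun c =>
        (L.conj (ρ c)).continuous_of_finiteDimensional
    exact h1.comp (QuotientGroup.continuous_mk.prodMap continuous_id)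
  · intro W _ hW
    rcases hρ.submodule_eq_bot_or_eq_top (W.comap L.toLinearMap) (fun c v hv => by
      obtain ⟨g, rfl⟩ := QuotientGroup.mk_surjective c
      have h1 := hW g (L v) hv
      have h2 : T g (L v) ∈ W := h1
      rw [hT, L.symm_apply_apply] at h2
      exact h2) with h | h
    · left
      rw [eq_bot_iff]
      intro x hx
      have : L.symm x ∈ W.comap L.toLinearMap := by simpa using hx
      rw [h, Submodule.mem_bot] at this
      simpa using this
    · right
      rw [eq_top_iff]
      intro x _
      have : L.symm x ∈ W.comap L.toLinearMap := h ▸ Submodule.mem_top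
      simpa using this
  · exact LinearMap.trace_conj' (ρ (g : G ⧸ N)) L

/-- Irreducible representations with the same character are isomorphic. -/
theorem Irrep.toClass_eq_of_character_eq [TotallyDisconnectedSpace G] [MeasurableSpace G]
    [BorelSpace G] (π σ : Irrep.{u, w} G) (h : π.character = σ.character) :
    π.toClass = σ.toClass := by
  obtain ⟨N, hN, hNo, hπN⟩ := π.exists_openNormal_trivial
  obtain ⟨M, hM, hMo, hσM⟩ := σ.exists_openNormal_trivial
  have hK : IsOpen ((N ⊓ M : Subgroup G) : Set G) := hNo.inter hMo
  have hπ : ∀ n ∈ N ⊓ M, π.ρ n = 1 := fun n hn => hπN n hn.1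
  have hσ : ∀ n ∈ N ⊓ M, σ.ρ n = 1 := fun n hn => hσM n hn.2
  have := π.finiteDimensional
  have := σ.finiteDimensional
  have : Finite (G ⧸ (N ⊓ M)) := (N ⊓ M).quotient_finite_of_isOpen hK
  have := Fintype.ofFinite (G ⧸ (N ⊓ M))
  obtain ⟨φ⟩ := (π.isIrreducible_quotientRep _ hK hπ).nonempty_equiv_of_character_eq
    (σ.isIrreducible_quotientRep _ hK hσ) (by
      funext c
      obtain ⟨g, rfl⟩ := QuotientGroup.mk_surjective c
      exact congrFun h g)
  refine Quotient.sound ⟨ContRepresentation.Equiv.mk φ.toLinearEquiv.toContinuousLinearEquiv ?_⟩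
  intro g
  ext v
  exact φ.toIntertwiningMap.isIntertwining _ _ (g : G ⧸ (N ⊓ M)) v

omit [IsTopologicalGroup G] [CompactSpace G] in
theorem Irrep.character_eq_of_toClass_eq (π σ : Irrep.{u, w} G) (h : π.toClass = σ.toClass) :
    π.character = σ.character := by
  obtain ⟨φ⟩ : Nonempty (π.ρ.Equiv σ.ρ) := Quotient.exact h
  funext g
  have h1 : (σ.ρ g : σ.V →ₗ[ℂ] σ.V) =
      φ.toContinuousLinearEquiv.toLinearEquiv.conj (π.ρ g : π.V →ₗ[ℂ] π.V) := by
    ext v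
    have := congrArg (fun T : π.V →L[ℂ] σ.V => T (φ.toContinuousLinearEquiv.symm v))
      (φ.isIntertwining g)
    simp only [ContinuousLinearMap.comp_apply, ContinuousLinearEquiv.coe_coe,
      ContinuousLinearEquiv.apply_symm_apply] at this
    exact this.symm
  rw [Irrep.character, Irrep.character, h1, LinearMap.trace_conj']

end Irrep

section Character

variable {G : Type u} [Group G] [TopologicalSpace G] [IsTopologicalGroup G] [CompactSpace G]
  [TotallyDisconnectedSpace G] [MeasurableSpace G] [BorelSpace G]

theorem Irrep.character_mem_classFun (π : Irrep.{u, w} G) : π.character ∈ ClassFun G := by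
  obtain ⟨N, hN, hNo, hπ⟩ := π.exists_openNormal_trivial
  refine ⟨mem_Fun_of_openNormal N hN hNo fun g n hn => ?_, fun g h => ?_⟩
  · rw [← π.character_quotientRep N hπ, ← π.character_quotientRep N hπ,
      QuotientGroup.mk_mul_of_mem g hn]
  · exact (π.ρ.toRepresentation).char_conj h g

theorem Irrep.character_one (π : Irrep.{u, w} G) : π.character 1 = Module.finrank ℂ π.V := by
  have := π.finiteDimensional
  exact π.ρ.toRepresentation.char_one

theorem Irrep.finrank_ne_zero (π : Irrep.{u, w} G) : (Module.finrank ℂ π.V : ℂ) ≠ 0 := by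
  have := π.finiteDimensional
  exact_mod_cast Module.finrank_pos.ne'

omit [MeasurableSpace G] [BorelSpace G] in
theorem exists_openNormal_of_mem_classFun {f : G → ℂ} (hf : f ∈ ClassFun G) :
    ∃ N : Subgroup G, N.Normal ∧ IsOpen (N : Set G) ∧ ∀ g, ∀ n ∈ N, f (g * n) = f g :=
  exists_openNormal_of_isLocallyConstant (isLocallyConstant_of_mem_Fun hf.1)

/-- The function induced on a quotient. -/
def descend (N : Subgroup G) (f : G → ℂ) (hf : ∀ g, ∀ n ∈ N, f (g * n) = f g) (c : G ⧸ N) : ℂ :=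
  Quotient.liftOn' c f fun a b hab => by
    rw [QuotientGroup.leftRel_apply] at hab
    rw [← hf a _ hab, mul_inv_cancel_left]

omit [IsTopologicalGroup G] [CompactSpace G] [TotallyDisconnectedSpace G] [MeasurableSpace G]
  [BorelSpace G] in
theorem descend_conj {f : G → ℂ} (hf : f ∈ ClassFun G) (N : Subgroup G) [N.Normal]
    (hfN : ∀ g, ∀ n ∈ N, f (g * n) = f g) (c d : G ⧸ N) :
    descend N f hfN (c * d * c⁻¹) = descend N f hfN d := by
  obtain ⟨g, rfl⟩ := QuotientGroup.mk_surjective c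
  obtain ⟨h, rfl⟩ := QuotientGroup.mk_surjective d
  exact hf.2 g h

theorem Irrep.exists_conv_character_eq (π : Irrep.{u, w} G) {f : G → ℂ} (hf : f ∈ ClassFun G) :
    ∃ c : ℂ, ∀ x, conv f π.character x = c * π.character x := by
  obtain ⟨N, hN, hNo, hπN⟩ := π.exists_openNormal_trivial
  obtain ⟨M, hM, hMo, hfM⟩ := exists_openNormal_of_mem_classFun hf
  have hK : IsOpen ((N ⊓ M : Subgroup G) : Set G) := hNo.inter hMo
  have hπ : ∀ n ∈ N ⊓ M, π.ρ n = 1 := fun n hn => hπN n hn.1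
  have hfK : ∀ g, ∀ n ∈ N ⊓ M, f (g * n) = f g := fun g n hn => hfM g n hn.2
  have := π.finiteDimensional
  have : Finite (G ⧸ (N ⊓ M)) := (N ⊓ M).quotient_finite_of_isOpen hK
  have := Fintype.ofFinite (G ⧸ (N ⊓ M))
  obtain ⟨c, -, hc⟩ := (π.isIrreducible_quotientRep _ hK hπ).exists_sum_mul_character_eq
    (descend _ f hfK) (descend_conj hf _ hfK)
  refine ⟨(Nat.card (G ⧸ (N ⊓ M)) : ℂ)⁻¹ * c, fun x => ?_⟩
  refine (conv_comp_quotientMk _ hK (descend _ f hfK) (π.quotientRep _ hπ).character x).trans ?_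
  rw [hc, mul_assoc]
  rfl

theorem Irrep.conv_character_self (π : Irrep.{u, w} G) (x : G) :
    conv π.character π.character x = (Module.finrank ℂ π.V : ℂ)⁻¹ * π.character x := by
  obtain ⟨N, hN, hNo, hπ⟩ := π.exists_openNormal_trivial
  have := π.finiteDimensional
  have : Finite (G ⧸ N) := N.quotient_finite_of_isOpen hNo
  have := Fintype.ofFinite (G ⧸ N)
  refine (conv_comp_quotientMk _ hNo (π.quotientRep _ hπ).character
    (π.quotientRep _ hπ).character x).trans ?_
  exact (π.isIrreducible_quotientRep _ hNo hπ).sum_character_mul_character x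

theorem Irrep.character_of_central (π : Irrep.{u, w} G) (z : G) (hz : ∀ g, g * z = z * g) :
    ∃ (c : ℂ) (n : ℕ), n ≠ 0 ∧ c ^ n = 1 ∧ π.character z = c * Module.finrank ℂ π.V := by
  obtain ⟨N, hN, hNo, hπ⟩ := π.exists_openNormal_trivial
  have := π.finiteDimensional
  have : Finite (G ⧸ N) := N.quotient_finite_of_isOpen hNo
  have := Fintype.ofFinite (G ⧸ N)
  obtain ⟨c, h1, h2⟩ := (π.isIrreducible_quotientRep _ hNo hπ).exists_pow_card_eq_one
    (z : G ⧸ N) (fun d => by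
      obtain ⟨g, rfl⟩ := QuotientGroup.mk_surjective d
      exact congrArg QuotientGroup.mk (hz g))
  exact ⟨c, _, Nat.card_pos.ne', h1, h2⟩

/-- A nonzero class function has a nonzero convolution with some irreducible character. -/
theorem exists_irrep_conv_ne_zero {f : G → ℂ} (hf : f ∈ ClassFun G) (hf0 : f ≠ 0) :
    ∃ π : Irrep.{u, w} G, ∃ x, conv f π.character x ≠ 0 := by
  obtain ⟨N, hN, hNo, hfN⟩ := exists_openNormal_of_mem_classFun hf
  have : Finite (G ⧸ N) := N.quotient_finite_of_isOpen hNo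
  have := Fintype.ofFinite (G ⧸ N)
  obtain ⟨V, _, _, _, ρ, hρ, hne⟩ := Representation.exists_isIrreducible_sum_ne_zero
    (descend N f hfN) (fun h0 => hf0 (funext fun g => congrFun h0 (g : G ⧸ N)))
  obtain ⟨π, hπ⟩ := exists_irrep_of_quotient.{u, u, w} N hNo ρ hρ
  obtain ⟨c, hc, hχ⟩ := hρ.exists_sum_mul_character_eq (descend N f hfN) (descend_conj hf N hfN)
  have hc0 : c ≠ 0 := fun h => hne (by rw [hc, h, zero_smul])
  refine ⟨π, 1, ?_⟩
  have hπ' : π.character = fun g : G => ρ.character (g : G ⧸ N) := funext hπ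
  have h1 := conv_comp_quotientMk N hNo (descend N f hfN) ρ.character 1
  rw [hχ, ← hπ, ← hπ', π.character_one] at h1
  exact h1.trans_ne (mul_ne_zero (by simp) (mul_ne_zero hc0 π.finrank_ne_zero))

end Character

/-- The circle has no small subgroups. -/
theorem circle_eq_one_of_forall_pow_re_pos (z : Circle)
    (h : ∀ n : ℕ, 0 < ((z ^ n : Circle) : ℂ).re) :
    z = 1 := by
  have hsq (w : Circle) : 1 - ((w ^ 2 : Circle) : ℂ).re = 2 * (1 - (w : ℂ).re ^ 2) := by
    have h1 := Circle.normSq_coe w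
    rw [Complex.normSq_apply] at h1
    rw [Circle.coe_pow, pow_two, Complex.mul_re]
    linarith
  have hle (w : Circle) : (w : ℂ).re ≤ 1 := by
    have h1 := Complex.re_le_norm (w : ℂ)
    rwa [Circle.norm_coe] at h1
  have hk (k : ℕ) : 2 ^ k * (1 - (z : ℂ).re) ≤ 1 - ((z ^ 2 ^ k : Circle) : ℂ).re := by
    induction k with
    | zero => simp
    | succ k ih =>
      have h1 := hsq (z ^ 2 ^ k)
      have h2 := h (2 ^ k)
      have h3 := hle (z ^ 2 ^ k)
      rw [← pow_mul, ← pow_succ] at h1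
      rw [h1, pow_succ]
      nlinarith
  have hre : (z : ℂ).re = 1 := by
    by_contra hne
    have hpos : 0 < 1 - (z : ℂ).re := by
      have := lt_of_le_of_ne (hle z) hne
      linarith
    obtain ⟨k, hk1⟩ := pow_unbounded_of_one_lt (1 / (1 - (z : ℂ).re)) one_lt_two
    rw [div_lt_iff₀ hpos] at hk1
    have h1 := hk k
    have h2 := h (2 ^ k)
    linarith
  apply Circle.ext
  apply Complex.ext
  · simpa using hre
  · have h1 := Circle.normSq_coe z
    rw [Complex.normSq_apply, hre] at h1
    have : (z : ℂ).im * (z : ℂ).im = 0 := by linarith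
    simpa using this

section Dual

variable {A : Type v} [AddCommGroup A] [TopologicalSpace A]

theorem Dual.eval_add (f : Dual A) (x y : A) : f.eval (x + y) = f.eval x * f.eval y := by
  simp [Dual.eval, ofAdd_add]

theorem Dual.eval_zero (f : Dual A) : f.eval 0 = 1 := by
  simp [Dual.eval]

theorem Dual.eval_ne_zero (f : Dual A) (x : A) : f.eval x ≠ 0 := Circle.coe_ne_zero _

theorem Dual.eval_neg (f : Dual A) (x : A) : f.eval (-x) = (f.eval x)⁻¹ := by
  simp [Dual.eval, ofAdd_neg]

theorem Dual.continuous_eval (f : Dual A) : Continuous f.eval :=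
  continuous_subtype_val.comp ((map_continuous f).comp continuous_ofAdd)

theorem Dual.eval_injective : Function.Injective (Dual.eval : Dual A → A → ℂ) := fun _ _ h =>
  PontryaginDual.ext fun a => Circle.ext (congrFun h a.toAdd)

theorem Dual.isLocallyConstant_eval [IsTopologicalAddGroup A] [CompactSpace A]
    [TotallyDisconnectedSpace A] (f : Dual A) : IsLocallyConstant f.eval := by
  have hU : IsOpen {x : A | 0 < (f.eval x).re} :=
    isOpen_lt continuous_const (Complex.continuous_re.comp f.continuous_eval)
  obtain ⟨B, hB⟩ := ProfiniteGrp.exist_openNormalAddSubgroup_sub_open_nhds_of_zero hU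
    (by simp [Dual.eval_zero])
  refine isLocallyConstant_of_forall_add_mem B.toAddSubgroup B.isOpen' fun x b hb => ?_
  have h1 : f (Multiplicative.ofAdd b) = 1 := by
    refine circle_eq_one_of_forall_pow_re_pos _ fun n => ?_
    rw [← map_pow, ← ofAdd_nsmul]
    exact hB (B.toAddSubgroup.nsmul_mem hb n)
  have h2 : f.eval b = 1 := by rw [Dual.eval, h1, Circle.coe_one]
  rw [Dual.eval_add, h2, mul_one]

/-- The sum of the characters in a finite set. -/
noncomputable def characterSum (S : Finset (Dual A)) (x : A) : ℂ := ∑ f ∈ S, f.eval x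

theorem characterSum_zero (S : Finset (Dual A)) : characterSum S 0 = S.card := by
  simp [characterSum, Dual.eval_zero]

theorem continuous_characterSum (S : Finset (Dual A)) : Continuous (characterSum S) :=
  continuous_finsetSum _ fun f _ => f.continuous_eval

end Dual

section Fourier

variable {A : Type v} [AddCommGroup A] [TopologicalSpace A] [IsTopologicalAddGroup A]
  [CompactSpace A] [MeasurableSpace A] [BorelSpace A]

/-- Fourier coefficients on a compact abelian group. -/
noncomputable def fourierCoefficient (f : Dual A) (F : A → ℂ) : ℂ :=
  ∫ y, f.eval (-y) * F y ∂(Measure.addHaarMeasure (⊤ : PositiveCompacts A))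

theorem addConv_eval (f : Dual A) (F : A → ℂ) (x : A) :
    addConv f.eval F x = fourierCoefficient f F * f.eval x := by
  have h := integral_sub_left_eq_self (fun y => f.eval (x - y) * F y)
    (Measure.addHaarMeasure (⊤ : PositiveCompacts A)) x
  simp only [sub_sub_cancel] at h
  rw [addConv, fourierCoefficient, ← integral_mul_const]
  simp only [neg_add_eq_sub]
  rw [h]
  congr 1
  funext y
  rw [sub_eq_neg_add, Dual.eval_add]
  ring

theorem fourierCoefficient_eval (f f' : Dual A) [Decidable (f = f')] :
    fourierCoefficient f f'.eval = if f = f' then 1 else 0 := by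
  split_ifs with h
  · subst h
    simp [fourierCoefficient, Dual.eval_neg, Dual.eval_ne_zero]
  · obtain ⟨a, ha⟩ : ∃ a, f.eval a ≠ f'.eval a := by
      by_contra! hcon
      exact h (Dual.eval_injective (funext hcon))
    have h1 := integral_add_left_eq_self (fun y => f.eval (-y) * f'.eval y)
      (μ := Measure.addHaarMeasure (⊤ : PositiveCompacts A)) a
    have h2 (y : A) : f.eval (-(a + y)) * f'.eval (a + y) =
        (f.eval (-a) * f'.eval a) * (f.eval (-y) * f'.eval y) := by
      rw [neg_add, Dual.eval_add, Dual.eval_add]; ring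
    simp only [h2] at h1
    rw [integral_const_mul] at h1
    change _ * fourierCoefficient f f'.eval = fourierCoefficient f f'.eval at h1
    by_contra hne
    have h3 := mul_eq_right₀ hne |>.1 h1
    rw [Dual.eval_neg, inv_mul_eq_one₀ (Dual.eval_ne_zero _ _)] at h3
    exact ha h3

theorem addConv_characterSum (S : Finset (Dual A)) {F : A → ℂ} (hF : Continuous F) (x : A) :
    addConv (characterSum S) F x = ∑ f ∈ S, fourierCoefficient f F * f.eval x := by
  simp only [← addConv_eval]
  simp only [addConv, characterSum, Finset.sum_mul]
  rw [integral_finsetSum]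
  intro f _
  exact integrable_addHaarMeasure_top
    (f.continuous_eval.mul (hF.comp (continuous_neg.add continuous_const)))

theorem fourierCoefficient_characterSum [DecidableEq (Dual A)] (f : Dual A) (S : Finset (Dual A)) :
    fourierCoefficient f (characterSum S) = if f ∈ S then 1 else 0 := by
  simp only [fourierCoefficient, characterSum, Finset.mul_sum]
  rw [integral_finsetSum]
  · change ∑ f' ∈ S, fourierCoefficient f f'.eval = _
    simp [fourierCoefficient_eval]
  · intro f' _
    exact integrable_addHaarMeasure_top
      ((f.continuous_eval.comp continuous_neg).mul f'.continuous_eval)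

theorem addConv_characterSum_characterSum [DecidableEq (Dual A)] (S T : Finset (Dual A)) :
    addConv (characterSum S) (characterSum T) = characterSum (S ∩ T) := by
  funext x
  rw [addConv_characterSum S (continuous_characterSum T)]
  simp only [fourierCoefficient_characterSum, ite_mul, one_mul, zero_mul, characterSum]
  rw [← Finset.sum_filter, Finset.filter_mem_eq_inter]

theorem fourierCoefficient_mul_characterSum [DecidableEq (Dual A)] (c : ℂ) (f : Dual A)
    (S : Finset (Dual A)) :
    fourierCoefficient f (fun x => c * characterSum S x) = c * if f ∈ S then 1 else 0 := by
  rw [← fourierCoefficient_characterSum]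
  simp only [fourierCoefficient, mul_left_comm _ c]
  rw [integral_const_mul]

theorem subset_of_mul_characterSum_eq {S T : Finset (Dual A)} {c d : ℂ} (hc : c ≠ 0)
    (h : ∀ x, c * characterSum S x = d * characterSum T x) : S ⊆ T := by
  classical
  intro f hf
  by_contra hfT
  have h1 := congrArg (fourierCoefficient f) (funext h)
  rw [fourierCoefficient_mul_characterSum, fourierCoefficient_mul_characterSum, if_pos hf,
    if_neg hfT, mul_one, mul_zero] at h1
  exact hc h1

/-- A nonzero locally constant function has a nonzero Fourier coefficient. -/
theorem exists_fourierCoefficient_ne_zero [TotallyDisconnectedSpace A] {F : A → ℂ}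
    (hF : IsLocallyConstant F) (hF0 : F ≠ 0) : ∃ f, fourierCoefficient f F ≠ 0 := by
  classical
  by_contra! hcon
  apply hF0
  obtain ⟨B, -, hBo, hFB⟩ := exists_add_openNormal_of_isLocallyConstant hF
  have : Finite (A ⧸ B) := B.quotient_finite_of_isOpen hBo
  have := Fintype.ofFinite (A ⧸ B)
  let F' : A ⧸ B → ℂ := fun c => Quotient.liftOn' c F fun a b hab => by
    rw [QuotientAddGroup.leftRel_apply] at hab
    rw [← hFB a _ hab, add_neg_cancel_left]
  have hzero (ψ : AddChar (A ⧸ B) ℂ) : ∑ c, ψ (-c) * F' c = 0 := by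
    let ψ' : AddChar (A ⧸ B) Circle := AddChar.circleEquivComplex.symm ψ
    have hψ (c : A ⧸ B) : (ψ' c : ℂ) = ψ c := by
      conv_rhs => rw [← AddChar.circleEquivComplex.apply_symm_apply ψ]
      rfl
    have hdis : DiscreteTopology (A ⧸ B) := QuotientAddGroup.discreteTopology hBo
    let f : Multiplicative A →ₜ* Circle :=
      { toFun := fun x => ψ' (QuotientAddGroup.mk x.toAdd)
        map_one' := ψ'.map_zero_eq_one
        map_mul' := fun x y => ψ'.map_add_eq_mul (x.toAdd : A ⧸ B) (y.toAdd : A ⧸ B)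
        continuous_toFun := (continuous_of_discreteTopology (f := ψ')).comp
          (QuotientAddGroup.continuous_mk.comp continuous_toAdd) }
    have h1 := hcon (f : Dual A)
    have h2 := integral_comp_add_quotientMk B hBo fun c => ψ (-c) * F' c
    have h3 : fourierCoefficient (f : Dual A) F =
        ∫ g, ψ (-(QuotientAddGroup.mk g : A ⧸ B)) * F' (QuotientAddGroup.mk g)
          ∂(Measure.addHaarMeasure (⊤ : PositiveCompacts A)) := by
      refine integral_congr_ae (Filter.Eventually.of_forall fun y => ?_)
      change (ψ' (QuotientAddGroup.mk (-y)) : ℂ) * F y = _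
      rw [hψ]
      rfl
    rw [← h3, h1] at h2
    simpa using h2.symm
  funext a
  have h1 : ∑ ψ : AddChar (A ⧸ B) ℂ, ψ (a : A ⧸ B) * ∑ c, ψ (-c) * F' c = 0 := by
    simp [hzero]
  simp only [Finset.mul_sum, ← mul_assoc, ← AddChar.map_add_eq_mul] at h1
  rw [Finset.sum_comm] at h1
  simp only [← Finset.sum_mul, AddChar.sum_apply_eq_ite, ← sub_eq_add_neg, sub_eq_zero, ite_mul,
    zero_mul, Finset.sum_ite_eq, Finset.mem_univ, if_true] at h1
  have h2 : F' (a : A ⧸ B) = 0 := by simpa using h1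
  exact h2

end Fourier

section Coadjoint

variable {G : Type u} [Group G] [TopologicalSpace G] {A : Type v} [AddCommGroup A]
  [TopologicalSpace A] (e : A ≃ₜ G)

omit [AddCommGroup A] in
theorem apply_Ad (g : G) (x : A) : e (Ad e g x) = g * e x * g⁻¹ := e.apply_symm_apply _

omit [AddCommGroup A] in
theorem Ad_mul (g h : G) (x : A) : Ad e (g * h) x = Ad e g (Ad e h x) := by
  apply e.injective
  simp only [apply_Ad, mul_inv_rev, mul_assoc]

omit [AddCommGroup A] in
theorem Ad_one (x : A) : Ad e 1 x = x := by
  apply e.injective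
  simp [apply_Ad]

variable [IsTopologicalGroup G]

omit [AddCommGroup A] in
theorem continuous_Ad (g : G) : Continuous (Ad e g) :=
  e.symm.continuous.comp ((continuous_const.mul e.continuous).mul continuous_const)

variable (hAd : ∀ (g : G) (x y : A), Ad e g (x + y) = Ad e g x + Ad e g y)

omit [IsTopologicalGroup G] in
include hAd in
theorem Ad_zero (g : G) : Ad e g 0 = 0 := by
  have := hAd g 0 0
  simpa using this

/-- The coadjoint action on characters. -/
noncomputable def coad (g : G) (f : Dual A) : Dual A :=
  ({ toFun := fun x => f (Multiplicative.ofAdd (Ad e g⁻¹ x.toAdd))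
     map_one' := by
      change f (Multiplicative.ofAdd (Ad e g⁻¹ 0)) = 1
      rw [Ad_zero e hAd, ofAdd_zero, map_one]
     map_mul' := fun x y => by
      rw [toAdd_mul, hAd, ofAdd_add, map_mul]
     continuous_toFun := (map_continuous f).comp
      (continuous_ofAdd.comp ((continuous_Ad e g⁻¹).comp continuous_toAdd)) } :
    Multiplicative A →ₜ* Circle)

theorem eval_coad (g : G) (f : Dual A) (x : A) :
    (coad e hAd g f).eval x = f.eval (Ad e g⁻¹ x) := rfl

theorem coad_mul (g h : G) (f : Dual A) :
    coad e hAd (g * h) f = coad e hAd g (coad e hAd h f) := by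
  apply Dual.eval_injective
  funext x
  simp only [eval_coad, mul_inv_rev, Ad_mul]

theorem coad_one (f : Dual A) : coad e hAd 1 f = f := by
  apply Dual.eval_injective
  funext x
  rw [eval_coad, inv_one, Ad_one]

theorem mem_coadjointOrbit {f f' : Dual A} :
    f' ∈ coadjointOrbit e f ↔ ∃ g, coad e hAd g f = f' := by
  refine exists_congr fun g => ?_
  rw [← Dual.eval_injective.eq_iff, funext_iff]
  exact forall_congr' fun x => eq_comm

include hAd

theorem self_mem_coadjointOrbit (f : Dual A) : f ∈ coadjointOrbit e f :=
  (mem_coadjointOrbit e hAd).2 ⟨1, coad_one e hAd f⟩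

theorem coadjointOrbit_eq_of_mem {f f' : Dual A} (h : f' ∈ coadjointOrbit e f) :
    coadjointOrbit e f' = coadjointOrbit e f := by
  obtain ⟨g, rfl⟩ := (mem_coadjointOrbit e hAd).1 h
  ext f''
  simp only [mem_coadjointOrbit e hAd, ← coad_mul]
  constructor
  · rintro ⟨k, rfl⟩
    exact ⟨k * g, rfl⟩
  · rintro ⟨k, rfl⟩
    exact ⟨k * g⁻¹, by rw [inv_mul_cancel_right]⟩

theorem coadjointOrbit_finite [CompactSpace G] [TotallyDisconnectedSpace G]
    [IsTopologicalAddGroup A] [CompactSpace A] [TotallyDisconnectedSpace A] (f : Dual A) :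
    (coadjointOrbit e f).Finite := by
  have hloc : IsLocallyConstant (f.eval ∘ e.symm) :=
    f.isLocallyConstant_eval.comp_continuous e.symm.continuous
  obtain ⟨N, hN, hNo, hinv⟩ := exists_openNormal_of_isLocallyConstant hloc
  have : Finite (G ⧸ N) := N.quotient_finite_of_isOpen hNo
  refine (Set.finite_range fun c : G ⧸ N => coad e hAd c.out f).subset fun f' hf' => ?_
  obtain ⟨g, rfl⟩ := (mem_coadjointOrbit e hAd).1 hf'
  refine ⟨(g : G ⧸ N), ?_⟩
  obtain ⟨n, hn⟩ := QuotientGroup.mk_out_eq_mul N g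
  simp only [hn]
  apply Dual.eval_injective
  funext x
  change (f.eval ∘ e.symm) ((g * n)⁻¹ * e x * (g * n)⁻¹⁻¹) =
    (f.eval ∘ e.symm) (g⁻¹ * e x * g⁻¹⁻¹)
  rw [← hinv (g⁻¹ * e x * g⁻¹⁻¹) ((g⁻¹ * (e x) * g)⁻¹ * (n : G)⁻¹ * (g⁻¹ * (e x) * g) * n)
    (N.mul_mem (hN.conj_mem' _ (N.inv_mem n.2) _) n.2)]
  congr 1
  group

theorem characterSum_Ad (S : Finset (Dual A)) (hS : ∀ g, ∀ f ∈ S, coad e hAd g f ∈ S)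
    (g : G) (x : A) : characterSum S (Ad e g x) = characterSum S x := by
  refine Finset.sum_nbij' (coad e hAd g⁻¹) (coad e hAd g) (hS _) (hS _) ?_ ?_ ?_
  · intro f _
    rw [← coad_mul, mul_inv_cancel, coad_one]
  · intro f _
    rw [← coad_mul, inv_mul_cancel, coad_one]
  · intro f _
    rw [eval_coad, inv_inv]

theorem measurePreserving_Ad [IsTopologicalAddGroup A] [CompactSpace A] [MeasurableSpace A]
    [BorelSpace A] (g : G) :
    MeasurePreserving (Ad e g) (Measure.addHaarMeasure (⊤ : PositiveCompacts A))
      (Measure.addHaarMeasure (⊤ : PositiveCompacts A)) :=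
  AddMonoidHom.measurePreserving (f := AddMonoidHom.mk' (Ad e g) (hAd g)) (continuous_Ad e g)
    (fun x => ⟨Ad e g⁻¹ x, by
      change Ad e g (Ad e g⁻¹ x) = x
      rw [← Ad_mul, mul_inv_cancel, Ad_one]⟩) rfl

theorem fourierCoefficient_coad [IsTopologicalAddGroup A] [CompactSpace A] [MeasurableSpace A]
    [BorelSpace A] (f : Dual A) {F : A → ℂ} (hFc : Continuous F)
    (hF : ∀ g x, F (Ad e g x) = F x) (g : G) :
    fourierCoefficient (coad e hAd g f) F = fourierCoefficient f F := by
  have hneg (x : A) : Ad e g⁻¹ (-x) = -Ad e g⁻¹ x :=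
    map_neg (AddMonoidHom.mk' (Ad e g⁻¹) (hAd g⁻¹)) x
  have hmp := measurePreserving_Ad e hAd g⁻¹
  have hc : Continuous fun y => f.eval (-y) * F y :=
    (f.continuous_eval.comp continuous_neg).mul hFc
  unfold fourierCoefficient
  conv_rhs => rw [← hmp.map_eq, integral_map hmp.aemeasurable
    (by rw [hmp.map_eq]; exact (integrable_addHaarMeasure_top hc).aestronglyMeasurable)]
  simp only [eval_coad, hneg, hF]

end Coadjoint

section Correspondence

variable {G : Type u} [Group G] [TopologicalSpace G] [IsTopologicalGroup G]
  [CompactSpace G] [TotallyDisconnectedSpace G]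
  {A : Type v} [AddCommGroup A] [TopologicalSpace A] [IsTopologicalAddGroup A]
  [CompactSpace A] [TotallyDisconnectedSpace A]
  (e : A ≃ₜ G) (hAd : ∀ (g : G) (x y : A), Ad e g (x + y) = Ad e g x + Ad e g y)

include hAd

/-- The coadjoint orbit of a character, as a finite set. -/
noncomputable def orbitFinset (f : Dual A) : Finset (Dual A) :=
  (coadjointOrbit_finite e hAd f).toFinset

theorem mem_orbitFinset {f f' : Dual A} :
    f' ∈ orbitFinset e hAd f ↔ f' ∈ coadjointOrbit e f := Set.Finite.mem_toFinset _

theorem card_orbitFinset_ne_zero (f : Dual A) : (orbitFinset e hAd f).card ≠ 0 :=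
  Finset.card_ne_zero_of_mem ((mem_orbitFinset e hAd).2 (self_mem_coadjointOrbit e hAd f))

theorem coad_mem_orbitFinset (f : Dual A) (g : G) (f' : Dual A) (h : f' ∈ orbitFinset e hAd f) :
    coad e hAd g f' ∈ orbitFinset e hAd f := by
  rw [mem_orbitFinset] at h ⊢
  rw [← coadjointOrbit_eq_of_mem e hAd h]
  exact (mem_coadjointOrbit e hAd).2 ⟨g, rfl⟩

theorem characterSum_orbitFinset_ne_zero (f : Dual A) : characterSum (orbitFinset e hAd f) ≠ 0 := by
  intro h
  have := congrFun h 0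
  rw [characterSum_zero, Pi.zero_apply] at this
  exact card_orbitFinset_ne_zero e hAd f (by exact_mod_cast this)

theorem characterSum_orbitFinset_comp_mem_classFun (f : Dual A) :
    characterSum (orbitFinset e hAd f) ∘ e.symm ∈ ClassFun G := by
  refine ⟨mem_Fun_of_isLocallyConstant ?_, fun g h => ?_⟩
  · refine IsLocallyConstant.comp_continuous ?_ e.symm.continuous
    have h1 (S : Finset (Dual A)) : IsLocallyConstant (characterSum S) := by
      classical
      induction S using Finset.induction_on with
      | empty => exact IsLocallyConstant.const 0
      | insert a S ha ih =>
        have : characterSum (insert a S) = a.eval + characterSum S := by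
          funext x
          exact Finset.sum_insert ha
        rw [this]
        exact a.isLocallyConstant_eval.add ih
    exact h1 _
  · have h1 := characterSum_Ad e hAd _ (coad_mem_orbitFinset e hAd f) g (e.symm h)
    rwa [Ad, e.apply_symm_apply] at h1

variable [MeasurableSpace G] [BorelSpace G] [MeasurableSpace A] [BorelSpace A]
  (hconv : ∀ f₁ ∈ ClassFun G, ∀ f₂ ∈ ClassFun G,
  conv f₁ f₂ ∘ e = addConv (f₁ ∘ e) (f₂ ∘ e))

include hconv

/-- Every irreducible character is, up to a scalar, a sum over a coadjoint orbit, and the size of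
the orbit is the square of the degree. -/
theorem Irrep.exists_orbit (π : Irrep.{u, w} G) :
    ∃ f : Dual A, (orbitFinset e hAd f).card = Module.finrank ℂ π.V ^ 2 ∧
      ∀ x, π.character (e x) =
        (Module.finrank ℂ π.V : ℂ)⁻¹ * characterSum (orbitFinset e hAd f) x := by
  classical
  have hd := π.finrank_ne_zero
  have hχ := π.character_mem_classFun
  have hFl : IsLocallyConstant (π.character ∘ e) :=
    (isLocallyConstant_of_mem_Fun hχ.1).comp_continuous e.continuous
  have hFAd (g : G) (x : A) : (π.character ∘ e) (Ad e g x) = (π.character ∘ e) x := by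
    simp only [Function.comp_apply, apply_Ad, hχ.2]
  have hF0 : π.character ∘ e ≠ 0 := fun h => hd (by
    have := congrFun h (e.symm 1)
    simpa [π.character_one] using this)
  obtain ⟨f, hf⟩ := exists_fourierCoefficient_ne_zero hFl hF0
  refine ⟨f, ?_⟩
  set S := orbitFinset e hAd f
  have hcoef : ∀ f' ∈ S, fourierCoefficient f' (π.character ∘ e) =
      fourierCoefficient f (π.character ∘ e) := by
    intro f' hf'
    obtain ⟨g, rfl⟩ := (mem_coadjointOrbit e hAd).1 ((mem_orbitFinset e hAd).1 hf')
    exact fourierCoefficient_coad e hAd f hFl.continuous hFAd g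
  have hSclass := characterSum_orbitFinset_comp_mem_classFun e hAd f
  obtain ⟨c, hc⟩ := π.exists_conv_character_eq hSclass
  have h1 (x : A) : c * π.character (e x) =
      fourierCoefficient f (π.character ∘ e) * characterSum S x := by
    have h2 := congrFun (hconv _ hSclass _ hχ) x
    rw [Function.comp_apply, hc, Function.comp_assoc, e.symm_comp_self, Function.comp_id,
      addConv_characterSum _ hFl.continuous, Finset.sum_congr rfl fun f' hf' => by
        rw [hcoef f' hf'], ← Finset.mul_sum] at h2
    exact h2
  have hS0 : (S.card : ℂ) ≠ 0 := by exact_mod_cast card_orbitFinset_ne_zero e hAd f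
  have hc0 : c ≠ 0 := by
    rintro rfl
    have h2 := h1 0
    rw [zero_mul, characterSum_zero] at h2
    exact mul_ne_zero hf hS0 h2.symm
  obtain ⟨k, hk⟩ : ∃ k : ℂ, ∀ x, π.character (e x) = k * characterSum S x :=
    ⟨c⁻¹ * fourierCoefficient f (π.character ∘ e), fun x => by
      rw [mul_assoc, ← h1, inv_mul_cancel_left₀ hc0]⟩
  have hk' : π.character ∘ e = fun x => k * characterSum S x := funext hk
  have hfk : fourierCoefficient f (π.character ∘ e) = k := by
    rw [hk', fourierCoefficient_mul_characterSum,
      if_pos ((mem_orbitFinset e hAd).2 (self_mem_coadjointOrbit e hAd f)), mul_one]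
  have hk0 : k ≠ 0 := hfk ▸ hf
  have hkd : k = (Module.finrank ℂ π.V : ℂ)⁻¹ := by
    have h2 := congrFun (hconv _ hχ _ hχ) 0
    have h3 : addConv (π.character ∘ e) (π.character ∘ e) 0 =
        k * addConv (characterSum S) (π.character ∘ e) 0 := by
      conv_lhs => rw [hk']
      simp only [addConv, hk', mul_assoc]
      rw [integral_const_mul]
    rw [h3, addConv_characterSum _ hFl.continuous, Finset.sum_congr rfl fun f' hf' => by
        rw [hcoef f' hf', hfk], ← Finset.mul_sum, Function.comp_apply, π.conv_character_self,
      hk] at h2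
    change _ = k * (k * characterSum S 0) at h2
    rw [characterSum_zero] at h2
    exact (mul_right_cancel₀ (mul_ne_zero hk0 hS0) h2).symm
  refine ⟨?_, fun x => hkd ▸ hk x⟩
  have hcentral (g : G) : g * e 0 = e 0 * g := by
    rw [← mul_inv_eq_iff_eq_mul, ← apply_Ad, Ad_zero e hAd]
  obtain ⟨ζ, n, hn, hζ, hζχ⟩ := π.character_of_central (e 0) hcentral
  rw [hk, characterSum_zero, hkd] at hζχ
  have h4 : ζ = (((S.card : ℝ) / (Module.finrank ℂ π.V : ℝ) ^ 2 : ℝ) : ℂ) := by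
    push_cast
    field_simp
    field_simp at hζχ
    linear_combination -hζχ
  rw [h4] at hζ
  have hd' : (Module.finrank ℂ π.V : ℝ) ≠ 0 := by exact_mod_cast hd
  have h5 : (S.card : ℝ) / (Module.finrank ℂ π.V : ℝ) ^ 2 = 1 :=
    (pow_eq_one_iff_of_nonneg (div_nonneg (Nat.cast_nonneg _) (sq_nonneg _)) hn).1
      (Complex.ofReal_injective (by rw [Complex.ofReal_pow, hζ, Complex.ofReal_one]))
  rw [div_eq_one_iff_eq (pow_ne_zero 2 hd')] at h5
  exact_mod_cast h5

/-- Every coadjoint orbit occurs. -/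
theorem exists_irrep_of_orbit (f : Dual A) :
    ∃ π : Irrep.{u, w} G, (orbitFinset e hAd f).card = Module.finrank ℂ π.V ^ 2 ∧
      ∀ x, π.character (e x) =
        (Module.finrank ℂ π.V : ℂ)⁻¹ * characterSum (orbitFinset e hAd f) x := by
  classical
  have hSclass := characterSum_orbitFinset_comp_mem_classFun e hAd f
  obtain ⟨π, y, hy⟩ := exists_irrep_conv_ne_zero.{u, w} hSclass (fun h => by
    apply characterSum_orbitFinset_ne_zero e hAd f
    funext x
    simpa using congrFun h (e x))
  refine ⟨π, ?_⟩
  obtain ⟨f', hcard, hf'⟩ := π.exists_orbit e hAd hconv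
  suffices h : orbitFinset e hAd f = orbitFinset e hAd f' by rw [h]; exact ⟨hcard, hf'⟩
  have h1 := congrFun (hconv _ hSclass _ π.character_mem_classFun) (e.symm y)
  have h2 : π.character ∘ e =
      fun x => (Module.finrank ℂ π.V : ℂ)⁻¹ * characterSum (orbitFinset e hAd f') x := funext hf'
  rw [Function.comp_apply, e.apply_symm_apply, Function.comp_assoc, e.symm_comp_self,
    Function.comp_id] at h1
  have h3 : addConv (characterSum (orbitFinset e hAd f)) (π.character ∘ e) (e.symm y) =
      (Module.finrank ℂ π.V : ℂ)⁻¹ * addConv (characterSum (orbitFinset e hAd f))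
        (characterSum (orbitFinset e hAd f')) (e.symm y) := by
    simp only [addConv, h2, mul_left_comm _ (Module.finrank ℂ π.V : ℂ)⁻¹]
    rw [integral_const_mul]
  rw [h3, addConv_characterSum_characterSum] at h1
  have hne : (orbitFinset e hAd f ∩ orbitFinset e hAd f').Nonempty := by
    rw [Finset.nonempty_iff_ne_empty]
    intro h0
    rw [h0] at h1
    exact hy (by simpa [characterSum] using h1)
  obtain ⟨f'', hf''⟩ := hne
  rw [Finset.mem_inter, mem_orbitFinset, mem_orbitFinset] at hf''
  ext f₀
  rw [mem_orbitFinset, mem_orbitFinset, ← coadjointOrbit_eq_of_mem e hAd hf''.1,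
    coadjointOrbit_eq_of_mem e hAd hf''.2]

end Correspondence

end OrbitMethod

open OrbitMethod

theorem theoremt {G : Type u} [Group G] [TopologicalSpace G] [IsTopologicalGroup G]
    [CompactSpace G] [T2Space G] [TotallyDisconnectedSpace G] [MeasurableSpace G] [BorelSpace G]
    {A : Type v} [AddCommGroup A] [TopologicalSpace A] [IsTopologicalAddGroup A]
    [CompactSpace A] [T2Space A] [TotallyDisconnectedSpace A] [MeasurableSpace A] [BorelSpace A]
    (e : A ≃ₜ G)
    (hAd : ∀ (g : G) (x y : A),
      OrbitMethod.Ad e g (x + y) = OrbitMethod.Ad e g x + OrbitMethod.Ad e g y)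
    (hconv : ∀ f₁ ∈ OrbitMethod.ClassFun G, ∀ f₂ ∈ OrbitMethod.ClassFun G,
      OrbitMethod.conv f₁ f₂ ∘ e = OrbitMethod.addConv (f₁ ∘ e) (f₂ ∘ e)) :
    ∃ hfin : ∀ Ω ∈ OrbitMethod.coadjointOrbits e, Ω.Finite,
      ∃ Φ : OrbitMethod.coadjointOrbits e ≃ OrbitMethod.IrrepClass.{u, w} G,
        ∀ (Ω : OrbitMethod.coadjointOrbits e) (π : OrbitMethod.Irrep.{u, w} G),
          π.toClass = Φ Ω →
            FiniteDimensional ℂ π.V ∧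
            ∀ x : A, π.character (e x) =
              (((hfin Ω Ω.2).toFinset.card : ℝ) ^ (-(1 / 2) : ℝ) : ℝ) *
                ∑ f ∈ (hfin Ω Ω.2).toFinset, f.eval x := by
  have hfin : ∀ Ω ∈ coadjointOrbits e, Ω.Finite := by
    rintro _ ⟨f, rfl⟩
    exact coadjointOrbit_finite e hAd f
  have key : ∀ Ω : coadjointOrbits e, ∃ π : Irrep.{u, w} G,
      (hfin Ω Ω.2).toFinset.card = Module.finrank ℂ π.V ^ 2 ∧
      ∀ x, π.character (e x) =
        (Module.finrank ℂ π.V : ℂ)⁻¹ * characterSum (hfin Ω Ω.2).toFinset x := by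
    rintro ⟨_, f, rfl⟩
    exact exists_irrep_of_orbit e hAd hconv f
  choose P hPcard hP using key
  have hdim (Ω : coadjointOrbits e) : (Module.finrank ℂ (P Ω).V : ℂ)⁻¹ =
      (((hfin Ω Ω.2).toFinset.card : ℝ) ^ (-(1 / 2) : ℝ) : ℝ) := by
    rw [hPcard, Nat.cast_pow, Real.rpow_neg (by positivity), ← Real.sqrt_eq_rpow,
      Real.sqrt_sq (by positivity)]
    push_cast
    rfl
  have hinj : Function.Injective fun Ω => (P Ω).toClass := by
    classical
    intro Ω Ω' h
    have h1 := Irrep.character_eq_of_toClass_eq _ _ h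
    have h2 (x : A) := (hP Ω x).symm.trans ((congrFun h1 (e x)).trans (hP Ω' x))
    have h3 := (subset_of_mul_characterSum_eq (inv_ne_zero (P Ω).finrank_ne_zero) h2).antisymm
      (subset_of_mul_characterSum_eq (inv_ne_zero (P Ω').finrank_ne_zero) fun x => (h2 x).symm)
    exact Subtype.ext (Set.Finite.toFinset_inj.1 h3)
  have hsurj : Function.Surjective fun Ω => (P Ω).toClass := by
    intro c
    obtain ⟨π, rfl⟩ : ∃ π : Irrep.{u, w} G, π.toClass = c := Quotient.exists_rep c
    obtain ⟨f, hcard, hf⟩ := π.exists_orbit e hAd hconv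
    let Ω : coadjointOrbits e := ⟨coadjointOrbit e f, f, rfl⟩
    refine ⟨Ω, Irrep.toClass_eq_of_character_eq _ _ (funext fun g => ?_)⟩
    obtain ⟨x, rfl⟩ := e.surjective g
    have hd : Module.finrank ℂ (P Ω).V = Module.finrank ℂ π.V :=
      Nat.pow_left_injective two_ne_zero ((hPcard Ω).symm.trans hcard)
    rw [hP, hf, hd]
    rfl
  refine ⟨hfin, Equiv.ofBijective _ ⟨hinj, hsurj⟩, fun Ω π hπ => ⟨π.finiteDimensional, fun x => ?_⟩⟩
  rw [Irrep.character_eq_of_toClass_eq _ _ hπ, hP, hdim]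
  rfl
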